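/- Let $d\in\mathbb N$, let $s$ be a real number with $-\frac1{d+1}<s<0$, and put $\beta=1+\frac1s<0$. Let $\mathcal G$ be the class of all convex, lower semicontinuous (closed) functions $g:\mathbb R^d\to[0,\infty]$ whose effective domain $\{g<\infty\}$ has non-empty interior and which are coercive, i.e. $g(x)\to\infty$ as $\|x\|\to\infty$. For a Borel probability measure $Q$ on $\mathbb R^d$ and $g\in\mathcal G$ let $$L(g,Q)=\int g\,dQ+\frac1{|\beta|}\int_{\mathbb R^d} g(x)^\beta\,dx\in[0,\infty],\qquad L(Q)=\inf_{g\in\mathcal G}L(g,Q),$$ with the conventions $0^\beta=\infty$ and $\infty^\beta=0$ (and likewise for the exponent $1/s$). Suppose that the convex support of $Q$, i.e. the intersection of all closed convex sets $C\subset\mathbb R^d$ with $Q(C)=1$, has non-empty interior. Then: (i) $L(Q)<\infty$ if and only if $\int\|x\|\,dQ(x)<\infty$. (ii) If $\int\|x\|\,dQ(x)<\infty$, then $L(\cdot,Q)$ attains its minimum over $\mathcal G$ at some $\tilde g\in\mathcal G$, the minimum value lies in $(0,\infty)$, and $\tilde g$ is the only minimizer in $\mathcal G$. Moreover, $\tilde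 g$ is bounded away from zero, i.e. $\inf_{x}\tilde g(x)>0$, and $\tilde f=\tilde g^{1/s}$ is a bounded probability density with respect to Lebesgue measure on $\mathbb R^d$. -/

import Mathlib

open MeasureTheory Filter Topology
open scoped ENNReal NNReal

/-- The intersection of all closed convex sets of full `Q`-mass, for a probability measure `Q`. -/
def convexSupport {d : ℕ} (Q : Measure (EuclideanSpace ℝ (Fin d))) :
    Set (EuclideanSpace ℝ (Fin d)) :=
  ⋂₀ {C | IsClosed C ∧ Convex ℝ C ∧ Q C = 1}

/-- `Q` has a finite first moment. -/
def HasFiniteFirstMoment {d : ℕ} (Q : Measure (EuclideanSpace ℝ (Fin d))) : Prop :=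
  ∫⁻ x, ‖x‖ₑ ∂Q < ∞

/-- The class of closed convex functions `g : ℝᵈ → [0, ∞]` whose effective domain
`{g < ∞}` has non-empty interior and which are coercive. Convexity is that of an
extended-real-valued function (with `0 * ∞ = 0`), and closedness is lower semicontinuity. -/
structure IsCoerciveClosedConvex {d : ℕ} (g : EuclideanSpace ℝ (Fin d) → ℝ≥0∞) : Prop where
  convex : ∀ x y : EuclideanSpace ℝ (Fin d), ∀ a b : ℝ, 0 ≤ a → 0 ≤ b → a + b = 1 →
    g (a • x + b • y) ≤ ENNReal.ofReal a * g x + ENNReal.ofReal b * g y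
  closed : LowerSemicontinuous g
  interior_dom : (interior {x | g x < ∞}).Nonempty
  coercive : Tendsto g (Bornology.cobounded (EuclideanSpace ℝ (Fin d))) (𝓝 ∞)

/-- The class of coercive closed convex functions as a set. -/
def coerciveClosedConvex (d : ℕ) : Set (EuclideanSpace ℝ (Fin d) → ℝ≥0∞) :=
  {g | IsCoerciveClosedConvex g}

/-- The Rényi functional `L_s(g, Q) = ∫ g dQ + |β|⁻¹ ∫ g ^ β dx`, `β = 1 + 1 / s`, with values
in `[0, ∞]`. For `β < 0` the powers are `0 ^ β = ∞` and `∞ ^ β = 0`. -/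
noncomputable def renyiFunctional {d : ℕ} (s : ℝ) (Q : Measure (EuclideanSpace ℝ (Fin d)))
    (g : EuclideanSpace ℝ (Fin d) → ℝ≥0∞) : ℝ≥0∞ :=
  ∫⁻ x, g x ∂Q + ENNReal.ofReal (|1 + 1 / s|⁻¹) * ∫⁻ x, (g x) ^ (1 + 1 / s)

/-- `L(Q) = inf_g L_s(g, Q)`, over all coercive closed convex `g`. -/
noncomputable def renyiInf {d : ℕ} (s : ℝ) (Q : Measure (EuclideanSpace ℝ (Fin d))) : ℝ≥0∞ :=
  ⨅ g ∈ coerciveClosedConvex d, renyiFunctional s Q g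

/-- `f` is a bounded probability density with respect to Lebesgue measure. -/
structure IsBoundedDensity {d : ℕ} (f : EuclideanSpace ℝ (Fin d) → ℝ≥0∞) : Prop where
  measurable : Measurable f
  lintegral_eq_one : ∫⁻ x, f x = 1
  bounded : ∃ M : ℝ≥0, ∀ x, f x ≤ M

/-! The hypothesis on `s` says exactly that `β < -d`. For (i), a coercive convex function grows at
least linearly (`exists_norm_le_of_coercive`), so a finite value forces a first moment; conversely
`1 + ‖x‖` is a competitor.

Existence is the direct method. A minimizing sequence has an epi-convergent subsequence, with no a
priori bounds needed, and both terms are lower semicontinuous along it by Fatou. For the power term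
(`EpiTendsto.lintegral_rpow_le_liminf`) this needs upper bounds on `g n`, which convexity supplies
on the interior of the limit's domain; the frontier is null. Finiteness of the functional returns
the limit to the class: it is finite `Q`-a.e., so its domain has interior, and an integrable
negative power bounds its sublevel sets.

If `g` vanishes at a point, shrinking a sublevel set towards it by `t` bounds the power integral
below by a multiple of `t ^ (d + β)`, which blows up. So `g > 0`, and coercivity gives a positive
lower bound. Strict convexity of `u ^ β` on positive values gives uniqueness, first a.e. and then
everywhere. Perturbing the minimizer by constants in both directions gives total mass one for `g ^
(1 / s)`. -/

theorem ENNReal.rpow_le_rpow_of_nonpos {x y : ℝ≥0∞} {z : ℝ} (h : x ≤ y) (hz : z ≤ 0) :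
    y ^ z ≤ x ^ z := by
  rw [← neg_neg z, ENNReal.rpow_neg, ENNReal.rpow_neg x]
  exact ENNReal.inv_le_inv.2 (ENNReal.rpow_le_rpow h (by linarith))

/-! ### Volume and boundedness of convex sets -/

section ConvexSets

variable {E : Type*} [NormedAddCommGroup E] [NormedSpace ℝ E] [FiniteDimensional ℝ E]
  [MeasurableSpace E] [BorelSpace E] (μ : Measure E) [μ.IsAddHaarMeasure]

theorem Convex.interior_nonempty_of_measure_pos {C : Set E} (hC : Convex ℝ C) (h : 0 < μ C) :
    (interior C).Nonempty := by
  by_contra hne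
  rw [Set.not_nonempty_iff_eq_empty] at hne
  have h1 : C ⊆ frontier C := by
    rw [frontier, hne, Set.sdiff_empty]
    exact subset_closure
  exact h.ne' (measure_mono_null h1 (hC.addHaar_frontier μ))

/-- A convex set of positive finite volume is bounded. -/
theorem Convex.isBounded_of_measure_lt_top {C : Set E} (hC : Convex ℝ C) (h : 0 < μ C)
    (hfin : μ C < ∞) : Bornology.IsBounded C := by
  obtain ⟨x₀, hx₀⟩ := hC.interior_nonempty_of_measure_pos μ h
  obtain ⟨r, hr, hball⟩ := Metric.mem_nhds_iff.1 (mem_interior_iff_mem_nhds.1 hx₀)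
  by_contra hunb
  have hm : 0 < μ (Metric.ball (0 : E) (r / 2)) := Metric.measure_ball_pos μ _ (by positivity)
  obtain ⟨N, hN⟩ := ENNReal.exists_nat_mul_gt hm.ne' hfin.ne
  have hN0 : 0 < (N : ℝ) := by
    rcases Nat.eq_zero_or_pos N with h0 | h0
    · simp [h0] at hN
    · exact_mod_cast h0
  obtain ⟨y, hy, hyd⟩ : ∃ y ∈ C, 2 * r * N < dist y x₀ := by
    by_contra! hcon
    exact hunb ((Metric.isBounded_closedBall (x := x₀) (r := 2 * r * N)).subset
      fun y hy => hcon y hy)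
  rw [dist_eq_norm] at hyd
  -- `N` equally spaced centres on the first half of the segment from `x₀` to `y`: there `C` still
  -- contains balls of radius `r / 2`, and the length `> 2 * r * N` makes them disjoint, so their
  -- total volume exceeds that of `C`.
  let z : ℕ → E := fun k => x₀ + ((k : ℝ) / (2 * N)) • (y - x₀)
  have hsub : ∀ k ∈ Finset.range N, Metric.ball (z k) (r / 2) ⊆ C := by
    intro k hk w hw
    have hk' : (k : ℝ) < N := by exact_mod_cast Finset.mem_range.1 hk
    set t : ℝ := (k : ℝ) / (2 * N) with ht
    have ht0 : 0 ≤ t := by positivity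
    have ht1 : t ≤ 1 / 2 := by
      rw [ht, div_le_iff₀ (by positivity)]
      linarith
    have hp : x₀ + (1 - t)⁻¹ • (w - z k) ∈ C := by
      apply hball
      rw [Metric.mem_ball, dist_eq_norm, add_sub_cancel_left, norm_smul, norm_inv,
        Real.norm_of_nonneg (by linarith : 0 ≤ 1 - t), inv_mul_lt_iff₀ (by linarith),
        ← dist_eq_norm]
      have := Metric.mem_ball.1 hw
      nlinarith
    have h1 := hC hp hy (by linarith : 0 ≤ 1 - t) ht0 (by ring)
    have h2 : (1 - t) • (x₀ + (1 - t)⁻¹ • (w - z k)) + t • y = w := by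
      rw [smul_add, smul_smul, mul_inv_cancel₀ (by linarith : (1 - t) ≠ 0)]
      simp only [z, ← ht]
      module
    rwa [h2] at h1
  have hdisj : (Finset.range N : Set ℕ).PairwiseDisjoint fun k => Metric.ball (z k) (r / 2) := by
    intro j _ k _ hjk
    apply Metric.ball_disjoint_ball
    rw [dist_eq_norm, add_halves]
    have h1 : z j - z k = (((j : ℝ) - k) / (2 * N)) • (y - x₀) := by
      simp only [z]
      module
    have h2 : (1 : ℝ) ≤ |(j : ℝ) - k| := by
      have : (1 : ℤ) ≤ |(j : ℤ) - k| := Int.one_le_abs (by omega)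
      exact_mod_cast this
    rw [h1, norm_smul, Real.norm_eq_abs, abs_div, abs_of_pos (by positivity : 0 < 2 * (N : ℝ)),
      div_mul_eq_mul_div, le_div_iff₀ (by positivity)]
    nlinarith [norm_nonneg (y - x₀)]
  have hsum : ∑ k ∈ Finset.range N, μ (Metric.ball (z k) (r / 2)) ≤ μ C := by
    rw [← measure_biUnion_finset hdisj fun k _ => Metric.isOpen_ball.measurableSet]
    exact measure_mono (Set.iUnion₂_subset hsub)
  simp only [Measure.addHaar_ball_center, Finset.sum_const, Finset.card_range,
    nsmul_eq_mul] at hsum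
  exact absurd hN (not_lt.2 hsum)

end ConvexSets

/-- The affine span of `D` is closed, convex and of full mass, so it contains the convex support and
is the whole space. Passing to the span avoids assuming `D` closed. -/
theorem interior_nonempty_of_convexSupport {d : ℕ} {Q : Measure (EuclideanSpace ℝ (Fin d))}
    [IsProbabilityMeasure Q] (hQ : (interior (convexSupport Q)).Nonempty)
    {D : Set (EuclideanSpace ℝ (Fin d))} (hD : Convex ℝ D) (hD1 : Q D = 1) :
    (interior D).Nonempty := by
  rw [hD.interior_nonempty_iff_affineSpan_eq_top]
  have h1 : convexSupport Q ⊆ affineSpan ℝ D := by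
    apply Set.sInter_subset_of_mem
    refine ⟨AffineSubspace.closed_of_finiteDimensional _, AffineSubspace.convex _,
      le_antisymm prob_le_one ?_⟩
    rw [← hD1]
    exact measure_mono (subset_affineSpan ℝ D)
  have h2 := affineSpan_mono ℝ (interior_subset.trans h1)
  rwa [IsOpen.affineSpan_eq_top isOpen_interior hQ, AffineSubspace.affineSpan_coe,
    top_le_iff] at h2

/-- Convexity of an extended-nonnegative-real-valued function. -/
def ENNRealConvex {E : Type*} [AddCommGroup E] [Module ℝ E] (g : E → ℝ≥0∞) : Prop :=
  ∀ x y : E, ∀ a b : ℝ, 0 ≤ a → 0 ≤ b → a + b = 1 →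
    g (a • x + b • y) ≤ ENNReal.ofReal a * g x + ENNReal.ofReal b * g y

/-! ### Convex functions with values in `[0, ∞]` -/

namespace ENNRealConvex

section Algebra

variable {E : Type*} [AddCommGroup E] [Module ℝ E] {g : E → ℝ≥0∞}

theorem of_pos (h : ∀ x y : E, ∀ a b : ℝ, 0 < a → 0 < b → a + b = 1 →
    g (a • x + b • y) ≤ ENNReal.ofReal a * g x + ENNReal.ofReal b * g y) : ENNRealConvex g := by
  intro x y a b ha hb hab
  rcases ha.eq_or_lt with rfl | ha
  · obtain rfl : b = 1 := by linarith
    simp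
  rcases hb.eq_or_lt with rfl | hb
  · obtain rfl : a = 1 := by linarith
    simp
  exact h x y a b ha hb hab

theorem convex_le (hg : ENNRealConvex g) (c : ℝ≥0∞) : Convex ℝ {x | g x ≤ c} := by
  intro x hx y hy a b ha hb hab
  calc g (a • x + b • y) ≤ ENNReal.ofReal a * g x + ENNReal.ofReal b * g y := hg x y a b ha hb hab
    _ ≤ ENNReal.ofReal a * c + ENNReal.ofReal b * c := by
        gcongr
        exacts [hx, hy]
    _ = c := by rw [← add_mul, ← ENNReal.ofReal_add ha hb, hab, ENNReal.ofReal_one, one_mul]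

theorem convex_lt_top (hg : ENNRealConvex g) : Convex ℝ {x | g x < ∞} := by
  intro x hx y hy a b ha hb hab
  exact (hg x y a b ha hb hab).trans_lt (ENNReal.add_lt_top.2
    ⟨ENNReal.mul_lt_top ENNReal.ofReal_lt_top hx, ENNReal.mul_lt_top ENNReal.ofReal_lt_top hy⟩)

theorem homothety_le (hg : ENNRealConvex g) (x y : E) {t : ℝ} (ht0 : 0 ≤ t) (ht1 : t ≤ 1) :
    g (AffineMap.homothety x t y) ≤ g x + ENNReal.ofReal t * g y := by
  have h1 : AffineMap.homothety x t y = (1 - t) • x + t • y := by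
    rw [AffineMap.homothety_apply, vsub_eq_sub, vadd_eq_add]
    module
  rw [h1]
  refine (hg x y (1 - t) t (by linarith) ht0 (by ring)).trans ?_
  gcongr
  exact mul_le_of_le_one_left' (ENNReal.ofReal_le_one.2 (by linarith))

theorem add {h : E → ℝ≥0∞} (hg : ENNRealConvex g) (hh : ENNRealConvex h) :
    ENNRealConvex fun x => g x + h x := by
  intro x y a b ha hb hab
  refine (add_le_add (hg x y a b ha hb hab) (hh x y a b ha hb hab)).trans_eq ?_
  ring

theorem const_mul (hg : ENNRealConvex g) (c : ℝ≥0∞) : ENNRealConvex fun x => c * g x := by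
  intro x y a b ha hb hab
  refine (mul_le_mul_right (hg x y a b ha hb hab) c).trans_eq ?_
  ring

theorem const (c : ℝ≥0∞) : ENNRealConvex fun _ : E => c := by
  intro x y a b ha hb hab
  rw [← add_mul, ← ENNReal.ofReal_add ha hb, hab, ENNReal.ofReal_one, one_mul]

theorem sub_const (hg : ENNRealConvex g) {c : ℝ≥0∞} (hcg : ∀ x, c ≤ g x) :
    ENNRealConvex fun x => g x - c := by
  intro x y a b ha hb hab
  rw [tsub_le_iff_right]
  refine (hg x y a b ha hb hab).trans_eq ?_
  calc ENNReal.ofReal a * g x + ENNReal.ofReal b * g y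
      = ENNReal.ofReal a * (g x - c + c) + ENNReal.ofReal b * (g y - c + c) := by
        rw [tsub_add_cancel_of_le (hcg x), tsub_add_cancel_of_le (hcg y)]
    _ = ENNReal.ofReal a * (g x - c) + ENNReal.ofReal b * (g y - c)
          + (ENNReal.ofReal a + ENNReal.ofReal b) * c := by ring
    _ = _ := by rw [← ENNReal.ofReal_add ha hb, hab, ENNReal.ofReal_one, one_mul]

end Algebra

variable {E : Type*} [NormedAddCommGroup E] [NormedSpace ℝ E] {g h : E → ℝ≥0∞}

theorem norm : ENNRealConvex fun x : E => ENNReal.ofReal ‖x‖ := by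
  intro x y a b ha hb hab
  rw [← ENNReal.ofReal_mul ha, ← ENNReal.ofReal_mul hb, ← ENNReal.ofReal_add (by positivity)
    (by positivity)]
  apply ENNReal.ofReal_le_ofReal
  refine (norm_add_le _ _).trans_eq ?_
  rw [norm_smul, norm_smul, Real.norm_of_nonneg ha, Real.norm_of_nonneg hb]

/-- A coercive convex function which is finite somewhere has at least linear growth. -/
theorem exists_norm_le_of_coercive (hg : ENNRealConvex g) {x₀ : E} (hx₀ : g x₀ < ∞)
    (hco : Tendsto g (Bornology.cobounded E) (𝓝 ∞)) :
    ∃ R : ℝ≥0, ∀ x, ‖x‖ₑ ≤ R * g x + R := by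
  have h1 : ∀ᶠ x in Bornology.cobounded E, g x₀ + 1 < g x :=
    hco.eventually (lt_mem_nhds (ENNReal.add_lt_top.2 ⟨hx₀, ENNReal.one_lt_top⟩))
  obtain ⟨R, hR⟩ := (Filter.hasBasis_cobounded_norm (E := E)).eventually_iff.1 h1
  obtain ⟨-, hR⟩ := hR
  set r : ℝ≥0 := Real.toNNReal R + ‖x₀‖₊ + 1 with hr
  have hr1 : R ≤ Real.toNNReal R := Real.le_coe_toNNReal R
  have hrpos : (0 : ℝ) < r := by positivity
  have hrval : (r : ℝ) = Real.toNNReal R + ‖x₀‖ + 1 := by simp [hr]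
  have key : ∀ x, ‖x - x₀‖ₑ ≤ r * g x + r := by
    intro x
    rcases le_or_gt ‖x - x₀‖ r with hle | hgt
    · refine le_trans ?_ le_add_self
      rw [enorm_le_coe]
      exact_mod_cast hle
    refine le_trans ?_ le_self_add
    have hn : 0 < ‖x - x₀‖ := hrpos.trans hgt
    -- This contraction moves `x` onto the sphere of radius `r` about `x₀`, which lies where `g`
    -- exceeds `g x₀ + 1`.
    set t : ℝ := r / ‖x - x₀‖ with ht
    have ht0 : 0 < t := by positivity
    have ht1 : t ≤ 1 := (div_le_one hn).2 hgt.le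
    have h2 : g x₀ + 1 < g (AffineMap.homothety x₀ t x) := by
      apply hR
      have h3 : ‖AffineMap.homothety x₀ t x - x₀‖ = r := by
        rw [AffineMap.homothety_apply, vsub_eq_sub, vadd_eq_add, add_sub_cancel_right, norm_smul,
          Real.norm_of_nonneg ht0.le, ht, div_mul_cancel₀ _ hn.ne']
      have h4 := norm_sub_le (AffineMap.homothety x₀ t x) x₀
      change R ≤ _
      have : (0 : ℝ) ≤ Real.toNNReal R := by positivity
      linarith
    have h3 : 1 ≤ ENNReal.ofReal t * g x := by
      have := h2.le.trans (hg.homothety_le x₀ x ht0.le ht1)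
      exact (ENNReal.add_le_add_iff_left hx₀.ne).1 this
    calc ‖x - x₀‖ₑ = ENNReal.ofReal ‖x - x₀‖ * 1 := by rw [mul_one, ofReal_norm]
      _ ≤ ENNReal.ofReal ‖x - x₀‖ * (ENNReal.ofReal t * g x) := by gcongr
      _ = r * g x := by
        rw [← mul_assoc, ← ENNReal.ofReal_mul (norm_nonneg _), ht, mul_div_cancel₀ _ hn.ne',
          ENNReal.ofReal_coe_nnreal]
  refine ⟨r + ‖x₀‖₊, fun x => ?_⟩
  calc ‖x‖ₑ = ‖(x - x₀) + x₀‖ₑ := by rw [sub_add_cancel]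
    _ ≤ ‖x - x₀‖ₑ + ‖x₀‖ₑ := enorm_add_le _ _
    _ ≤ r * g x + r + ‖x₀‖ₑ := by gcongr; exact key x
    _ ≤ _ := by
      have hle : (r : ℝ≥0∞) ≤ ((r + ‖x₀‖₊ : ℝ≥0) : ℝ≥0∞) :=
        ENNReal.coe_le_coe.2 (le_add_of_nonneg_right (zero_le))
      have heq : (r : ℝ≥0∞) + ‖x₀‖ₑ = ((r + ‖x₀‖₊ : ℝ≥0) : ℝ≥0∞) := (ENNReal.coe_add _ _).symm
      rw [add_assoc, heq]
      exact add_le_add (mul_le_mul' hle le_rfl) le_rfl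

/-- Bounded sublevel sets exhaust the domain, so countable subadditivity makes one of them non-null;
a single `c` serves as both level and radius. -/
theorem exists_measure_sublevel_pos {E : Type*} [NormedAddCommGroup E] [MeasurableSpace E]
    (μ : Measure E) [μ.IsOpenPosMeasure] {g : E → ℝ≥0∞}
    (hdom : (interior {x | g x < ∞}).Nonempty) :
    ∃ c : ℝ≥0, 0 < c ∧ 0 < μ ({x | g x ≤ c} ∩ Metric.closedBall 0 c) := by
  have h1 : {x | g x < ∞} ⊆ ⋃ n : ℕ, ({x | g x ≤ ((n + 1 : ℕ) : ℝ≥0)} ∩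
      Metric.closedBall 0 ((n + 1 : ℕ) : ℝ≥0)) := by
    intro x hx
    obtain ⟨n, hn⟩ := ENNReal.exists_nat_gt (ne_of_lt hx)
    obtain ⟨m, hm⟩ := exists_nat_gt ‖x‖
    refine Set.mem_iUnion.2 ⟨max n m, ?_, ?_⟩
    · refine hn.le.trans ?_
      rw [ENNReal.coe_natCast]
      exact_mod_cast (le_max_left n m).trans (Nat.le_succ _)
    · rw [mem_closedBall_zero_iff]
      refine hm.le.trans ?_
      rw [NNReal.coe_natCast]
      exact_mod_cast (le_max_right n m).trans (Nat.le_succ _)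
  have h2 : 0 < μ (⋃ n : ℕ, ({x | g x ≤ ((n + 1 : ℕ) : ℝ≥0)} ∩
      Metric.closedBall 0 ((n + 1 : ℕ) : ℝ≥0))) :=
    (isOpen_interior.measure_pos μ hdom).trans_le (measure_mono (interior_subset.trans h1))
  obtain ⟨n, hn⟩ := exists_measure_pos_of_not_measure_iUnion_null h2.ne'
  exact ⟨((n + 1 : ℕ) : ℝ≥0), by positivity, hn⟩

variable [FiniteDimensional ℝ E] [MeasurableSpace E] [BorelSpace E] (μ : Measure E)
  [μ.IsAddHaarMeasure]

/-- If a negative power of a convex function is integrable, then the function is coercive. -/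
theorem coercive_of_lintegral_rpow_lt_top (hg : ENNRealConvex g) (hgm : Measurable g)
    (hdom : (interior {x | g x < ∞}).Nonempty) {β : ℝ} (hβ : β < 0)
    (hfin : ∫⁻ x, g x ^ β ∂μ < ∞) : Tendsto g (Bornology.cobounded E) (𝓝 ∞) := by
  obtain ⟨c₀, hc₀, hpos⟩ := exists_measure_sublevel_pos μ hdom
  rw [ENNReal.tendsto_nhds_top_iff_nnreal]
  intro b
  -- Raising the level to `c₀` gives the sublevel set positive volume; Markov's inequality makes
  -- that volume finite, so the set is bounded.
  set c : ℝ≥0 := max b c₀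
  have hc : 0 < c := hc₀.trans_le (le_max_right _ _)
  have h1 : μ {x | g x ≤ c} < ∞ := by
    have h2 := mul_meas_ge_le_lintegral₀ (μ := μ) (hgm.pow_const β).aemeasurable ((c : ℝ≥0∞) ^ β)
    have h3 : μ {x | g x ≤ c} ≤ μ {x | (c : ℝ≥0∞) ^ β ≤ g x ^ β} :=
      measure_mono fun x hx => ENNReal.rpow_le_rpow_of_nonpos hx hβ.le
    refine h3.trans_lt (ENNReal.lt_top_of_mul_ne_top_right (h2.trans_lt hfin).ne ?_)
    exact (ENNReal.rpow_pos (by exact_mod_cast hc) ENNReal.coe_ne_top).ne'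
  have h2 : 0 < μ {x | g x ≤ c} := by
    refine hpos.trans_le (measure_mono (Set.inter_subset_left.trans fun x hx => ?_))
    exact (show g x ≤ c₀ from hx).trans (by exact_mod_cast le_max_right b c₀)
  have h3 := (hg.convex_le c).isBounded_of_measure_lt_top μ h2 h1
  filter_upwards [Bornology.isBounded_def.1 h3] with x hx
  have : (c : ℝ≥0∞) < g x := not_le.1 hx
  exact lt_of_le_of_lt (by exact_mod_cast le_max_left b c₀) this

/-- A convex function vanishing at a point has a non-integrable power of exponent `< -dim`. -/
theorem pos_of_lintegral_rpow_lt_top (hg : ENNRealConvex g) (hgm : Measurable g)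
    (hdom : (interior {x | g x < ∞}).Nonempty) {β : ℝ} (hβ : β < -(Module.finrank ℝ E : ℝ))
    (hfin : ∫⁻ x, g x ^ β ∂μ < ∞) (x₀ : E) : 0 < g x₀ := by
  rw [pos_iff_ne_zero]
  intro h0
  obtain ⟨c, hc, hpos⟩ := exists_measure_sublevel_pos μ hdom
  have hpos : 0 < μ {x | g x ≤ c} := hpos.trans_le (measure_mono Set.inter_subset_left)
  have hβ0 : β < 0 := hβ.trans_le (by simp)
  set n := Module.finrank ℝ E
  have hγ : 0 < -(n + β) := by linarith
  have key : ∀ t : ℝ≥0, 0 < t → t ≤ 1 →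
      (t : ℝ≥0∞) ^ (n + β) * ((c : ℝ≥0∞) ^ β * μ {x | g x ≤ c}) ≤ ∫⁻ x, g x ^ β ∂μ := by
    intro t ht0 ht1
    have h2 := mul_meas_ge_le_lintegral₀ (μ := μ) (hgm.pow_const β).aemeasurable
      (((t * c : ℝ≥0) : ℝ≥0∞) ^ β)
    have h3 : AffineMap.homothety x₀ (t : ℝ) '' {x | g x ≤ c} ⊆
        {x | ((t * c : ℝ≥0) : ℝ≥0∞) ^ β ≤ g x ^ β} := by
      rintro _ ⟨y, hy, rfl⟩
      refine ENNReal.rpow_le_rpow_of_nonpos ?_ hβ0.le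
      refine (hg.homothety_le x₀ y t.coe_nonneg (by exact_mod_cast ht1)).trans ?_
      rw [h0, zero_add, ENNReal.ofReal_coe_nnreal, ENNReal.coe_mul]
      gcongr
      exact hy
    refine le_trans ?_ ((mul_le_mul_right (measure_mono h3) _).trans h2)
    rw [Measure.addHaar_image_homothety, abs_of_nonneg (by positivity),
      ENNReal.ofReal_pow t.coe_nonneg, ENNReal.ofReal_coe_nnreal, ENNReal.coe_mul,
      ENNReal.coe_mul_rpow, ENNReal.rpow_add _ _ (by exact_mod_cast ht0.ne') ENNReal.coe_ne_top,
      ENNReal.rpow_natCast]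
    apply le_of_eq
    ring
  set K := (c : ℝ≥0∞) ^ β * μ {x | g x ≤ c} with hK
  have hK0 : K ≠ 0 := mul_ne_zero
    (ENNReal.rpow_pos (by exact_mod_cast hc) ENNReal.coe_ne_top).ne' hpos.ne'
  obtain ⟨N, hN⟩ := ENNReal.exists_nat_mul_gt hK0 hfin.ne
  have hN0 : (1 : ℝ≥0) ≤ (N : ℝ≥0) := by
    rcases Nat.eq_zero_or_pos N with h | h
    · simp [h] at hN
    · exact_mod_cast h
  have hexp : (n + β)⁻¹ ≤ 0 := inv_nonpos.2 (by linarith)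
  -- The contraction ratio is chosen so that `t ^ (n + β) = N`.
  have h1 := key ((N : ℝ≥0) ^ (n + β)⁻¹) (NNReal.rpow_pos (by positivity))
    (NNReal.rpow_le_one_of_one_le_of_nonpos hN0 hexp)
  rw [ENNReal.coe_rpow_of_ne_zero (by positivity), ENNReal.rpow_inv_rpow (by linarith),
    ENNReal.coe_natCast] at h1
  exact absurd hN (not_lt.2 h1)

/-- Contracting a bounded sublevel set of `h` towards `x` gives positive-measure sets arbitrarily
near `x` on which `h ≤ h x + t * c`. Each meets the set where `g = h`, and lower semicontinuity of
`g` carries the bound to `x`. -/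
theorem le_of_ae_eq (hh : ENNRealConvex h) (hg : LowerSemicontinuous g)
    (hdom : (interior {x | h x < ∞}).Nonempty) (hgh : g =ᵐ[μ] h) : g ≤ h := by
  intro x
  by_contra! hlt
  obtain ⟨q, hq1, hq2⟩ := exists_between hlt
  obtain ⟨c, hc, hpos⟩ := exists_measure_sublevel_pos μ hdom
  obtain ⟨δ, hδ, hball⟩ := Metric.eventually_nhds_iff.1 (hg x q hq2)
  have hlim : Tendsto (fun t : ℝ => h x + ENNReal.ofReal t * c) (𝓝[>] 0) (𝓝 (h x)) := by
    have h1 : Tendsto (fun t : ℝ => h x + ENNReal.ofReal t * c) (𝓝[>] 0)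
        (𝓝 (h x + ENNReal.ofReal 0 * c)) := by
      refine tendsto_const_nhds.add (ENNReal.Tendsto.mul_const ?_ (Or.inr ENNReal.coe_ne_top))
      exact (ENNReal.continuous_ofReal.tendsto 0).mono_left nhdsWithin_le_nhds
    simpa using h1
  have hlim2 : Tendsto (fun t : ℝ => t * (c + ‖x‖)) (𝓝[>] 0) (𝓝 0) := by
    have h1 : Tendsto (fun t : ℝ => t * (c + ‖x‖)) (𝓝 0) (𝓝 (0 * (c + ‖x‖))) :=
      (continuous_id.mul continuous_const).tendsto 0
    rw [zero_mul] at h1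
    exact h1.mono_left nhdsWithin_le_nhds
  obtain ⟨t, ht1, ht2, ht0, htle⟩ := ((hlim.eventually (gt_mem_nhds hq1)).and
    ((hlim2.eventually (gt_mem_nhds hδ)).and
      (Ioo_mem_nhdsGT (zero_lt_one (α := ℝ))))).exists
  have hpos' : 0 < μ (AffineMap.homothety x t '' ({x | h x ≤ c} ∩ Metric.closedBall 0 c)) := by
    rw [Measure.addHaar_image_homothety]
    exact ENNReal.mul_pos (ENNReal.ofReal_pos.2 (abs_pos.2 (pow_pos ht0 _).ne')).ne' hpos.ne'
  obtain ⟨y, ⟨z, ⟨hz, hzb⟩, rfl⟩, hy⟩ := ((frequently_ae_mem_iff.2 hpos'.ne').and_eventually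
    hgh).exists
  have h1 : q < g (AffineMap.homothety x t z) := by
    apply hball
    rw [AffineMap.homothety_apply, vsub_eq_sub, vadd_eq_add, dist_eq_norm, add_sub_cancel_right,
      norm_smul, Real.norm_of_nonneg ht0.le]
    refine lt_of_le_of_lt ?_ ht2
    gcongr
    exact (norm_sub_le _ _).trans (add_le_add_left (mem_closedBall_zero_iff.1 hzb) _)
  rw [hy] at h1
  refine absurd (h1.trans_le ((hh.homothety_le x z ht0.le htle.le).trans ?_)) (not_lt.2 ht1.le)
  gcongr
  exact hz

end ENNRealConvex

/-- Epi-convergence (Γ-convergence) of a sequence of `[0, ∞]`-valued functions. -/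
def EpiTendsto {X : Type*} [TopologicalSpace X] (g : ℕ → X → ℝ≥0∞) (G : X → ℝ≥0∞) : Prop :=
  ∀ x, (∀ c < G x, ∃ U ∈ 𝓝 x, ∀ᶠ n in atTop, ∀ p ∈ U, c < g n p) ∧
    ∀ c, G x < c → ∀ U ∈ 𝓝 x, ∀ᶠ n in atTop, ∃ p ∈ U, g n p < c

/-! ### Epi-convergence: compactness and lower semicontinuity -/

section Topology

variable {X : Type*} [TopologicalSpace X]

/-- Sequential compactness of epi-convergence. -/
theorem exists_epiTendsto_subseq [SecondCountableTopology X] (g : ℕ → X → ℝ≥0∞) :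
    ∃ φ : ℕ → ℕ, StrictMono φ ∧ ∃ G, EpiTendsto (fun n => g (φ n)) G := by
  let B := TopologicalSpace.countableBasis X
  have hB := TopologicalSpace.isBasis_countableBasis X
  have : Countable B := (TopologicalSpace.countable_countableBasis X).to_subtype
  -- The infima over basic open sets form a point of a countable power of `[0, ∞]`, which is
  -- sequentially compact.
  obtain ⟨M, φ, hφ, hM⟩ := CompactSpace.tendsto_subseq
    (fun (n : ℕ) (U : B) => ⨅ p ∈ (U : Set X), g n p)
  rw [tendsto_pi_nhds] at hM
  refine ⟨φ, hφ, fun x => ⨆ U : B, ⨆ _ : x ∈ (U : Set X), M U, fun x => ⟨fun c hc => ?_,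
    fun c hc V hV => ?_⟩⟩
  · simp only [lt_iSup_iff] at hc
    obtain ⟨U, hxU, hcU⟩ := hc
    refine ⟨U, (hB.isOpen U.2).mem_nhds hxU, ?_⟩
    filter_upwards [(hM U).eventually (lt_mem_nhds hcU)] with n hn p hp
    exact hn.trans_le (iInf₂_le p hp)
  · obtain ⟨U, hUB, hxU, hUV⟩ := hB.mem_nhds_iff.1 hV
    have h1 : M ⟨U, hUB⟩ < c :=
      lt_of_le_of_lt (le_iSup₂ (f := fun (U : B) (_ : x ∈ (U : Set X)) => M U) ⟨U, hUB⟩ hxU) hc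
    filter_upwards [(hM ⟨U, hUB⟩).eventually (gt_mem_nhds h1)] with n hn
    simp only [Function.comp_apply, iInf_lt_iff] at hn
    obtain ⟨p, hp, hpc⟩ := hn
    exact ⟨p, hUV hp, hpc⟩

namespace EpiTendsto

variable {g : ℕ → X → ℝ≥0∞} {G : X → ℝ≥0∞}

theorem lowerSemicontinuous (h : EpiTendsto g G) : LowerSemicontinuous G := by
  intro x c hc
  obtain ⟨c', hc1, hc2⟩ := exists_between hc
  obtain ⟨U, hU, hUn⟩ := (h x).1 c' hc2
  filter_upwards [eventually_mem_nhds_iff.2 hU] with y hy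
  refine hc1.trans_le ?_
  by_contra! hlt
  obtain ⟨n, hn, p, hp, hpc⟩ := (hUn.and ((h y).2 c' hlt U hy)).exists
  exact lt_asymm hpc (hn p hp)

theorem le_liminf (h : EpiTendsto g G) (x : X) : G x ≤ liminf (fun n => g n x) atTop := by
  refine le_of_forall_lt fun c hc => ?_
  obtain ⟨c', hc1, hc2⟩ := exists_between hc
  obtain ⟨U, hU, hUn⟩ := (h x).1 c' hc2
  refine hc1.trans_le (le_liminf_of_le (by isBoundedDefault) ?_)
  filter_upwards [hUn] with n hn
  exact (hn x (mem_of_mem_nhds hU)).le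

theorem lintegral_le_liminf [MeasurableSpace X] [BorelSpace X] (h : EpiTendsto g G)
    (hgc : ∀ n, LowerSemicontinuous (g n)) (Q : Measure X) :
    ∫⁻ x, G x ∂Q ≤ liminf (fun n => ∫⁻ x, g n x ∂Q) atTop :=
  (lintegral_mono h.le_liminf).trans (lintegral_liminf_le fun n => (hgc n).measurable)

end EpiTendsto

end Topology

theorem EpiTendsto.ennrealConvex {E : Type*} [AddCommGroup E] [Module ℝ E] [TopologicalSpace E]
    [ContinuousAdd E] [ContinuousConstSMul ℝ E] {g : ℕ → E → ℝ≥0∞} {G : E → ℝ≥0∞}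
    (h : EpiTendsto g G) (hg : ∀ n, ENNRealConvex (g n)) : ENNRealConvex G := by
  refine ENNRealConvex.of_pos fun x y a b ha hb hab => ?_
  refine ENNReal.le_of_forall_pos_le_add fun ε hε hfin => ?_
  have hε' : (ε : ℝ≥0∞) ≠ 0 := by exact_mod_cast hε.ne'
  -- Both weights are positive, so a finite right-hand side forces finite values at `x` and `y`, as
  -- needed for recovery points below `G x + ε` and `G y + ε`.
  have hx : G x ≠ ∞ := fun hx => by simp [hx, ha] at hfin
  have hy : G y ≠ ∞ := fun hy => by simp [hy, hb] at hfin
  by_contra! hlt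
  obtain ⟨U, hU, hUn⟩ := (h _).1 _ hlt
  have hcont : ContinuousAt (fun p : E × E => a • p.1 + b • p.2) (x, y) := by fun_prop
  obtain ⟨V, hV, W, hW, hVW⟩ := mem_nhds_prod_iff.1 (hcont hU)
  obtain ⟨n, hn, ⟨p, hp, hpc⟩, q, hq, hqc⟩ := (hUn.and
    (((h x).2 _ (ENNReal.lt_add_right hx hε') V hV).and
      ((h y).2 _ (ENNReal.lt_add_right hy hε') W hW))).exists
  have h1 := hn (a • p + b • q) (hVW (Set.mk_mem_prod hp hq))
  refine absurd (h1.trans_le (hg n p q a b ha.le hb.le hab)) (not_lt.2 ?_)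
  calc ENNReal.ofReal a * g n p + ENNReal.ofReal b * g n q
      ≤ ENNReal.ofReal a * (G x + ε) + ENNReal.ofReal b * (G y + ε) := by gcongr
    _ = ENNReal.ofReal a * G x + ENNReal.ofReal b * G y
          + (ENNReal.ofReal a + ENNReal.ofReal b) * ε := by ring
    _ = _ := by rw [← ENNReal.ofReal_add ha.le hb.le, hab, ENNReal.ofReal_one, one_mul]

/-! ### Epi-limits of convex functions in finite dimension -/

section InnerProduct

variable {E : Type*} [NormedAddCommGroup E] [InnerProductSpace ℝ E]

/-- A closed convex set which is `ρ / 2`-dense in a ball of radius `ρ` contains the concentric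
ball of half the radius. -/
theorem Convex.closedBall_subset_of_dense [CompleteSpace E] {C : Set E} (hC : Convex ℝ C)
    (hCc : IsClosed C) {x : E} {ρ : ℝ} (hρ : 0 ≤ ρ)
    (h : ∀ w ∈ Metric.closedBall x ρ, ∃ p ∈ C, dist p w ≤ ρ / 2) :
    Metric.closedBall x (ρ / 2) ⊆ C := by
  intro y hy
  by_contra hyC
  obtain ⟨f, u, hf, hfu⟩ := geometric_hahn_banach_closed_point hC hCc hyC
  set v := (InnerProductSpace.toDual ℝ E).symm f
  have hfv : ∀ z, f z = inner ℝ v z := fun z => by simp [v]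
  -- Moving by `ρ` in the separating direction gains `ρ * ‖v‖`; the approximating point `p` and the
  -- position of `y` each cost at most half of that, so `f p < f y` fails.
  obtain ⟨w, hw, hwv⟩ : ∃ w ∈ Metric.closedBall x ρ, inner ℝ v (w - x) = ρ * ‖v‖ := by
    refine ⟨x + (ρ * ‖v‖⁻¹) • v, ?_, ?_⟩
    · rw [mem_closedBall_iff_norm, add_sub_cancel_left, norm_smul, norm_mul, norm_inv, norm_norm,
        Real.norm_of_nonneg hρ, mul_assoc]
      exact mul_le_of_le_one_right hρ inv_mul_le_one
    · rw [add_sub_cancel_left, inner_smul_right, real_inner_self_eq_norm_sq]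
      rcases eq_or_ne ‖v‖ 0 with h0 | h0
      · simp [h0]
      · field_simp
  obtain ⟨p, hp, hpw⟩ := h w hw
  have h1 : f p < f y := (hf p hp).trans hfu
  have h2 : f p - f y = inner ℝ v (w - x) + inner ℝ v (p - w) - inner ℝ v (y - x) := by
    simp only [hfv, inner_sub_right]
    ring
  have h3 : -(‖v‖ * ‖p - w‖) ≤ inner ℝ v (p - w) := neg_le_of_abs_le (abs_real_inner_le_norm _ _)
  have h4 := real_inner_le_norm v (y - x)
  rw [dist_eq_norm] at hpw
  rw [mem_closedBall_iff_norm] at hy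
  have h5 := mul_le_mul_of_nonneg_left hpw (norm_nonneg v)
  have h6 := mul_le_mul_of_nonneg_left hy (norm_nonneg v)
  linarith

namespace EpiTendsto

variable [FiniteDimensional ℝ E] {g : ℕ → E → ℝ≥0∞} {G : E → ℝ≥0∞}

/-- Epi-convergence gives recovery points near finitely many centres covering a ball. Their common
sublevel set is closed, convex and dense enough in that ball to contain a smaller one. -/
theorem eventually_bounded_of_mem_interior (h : EpiTendsto g G) (hg : ∀ n, ENNRealConvex (g n))
    (hgc : ∀ n, LowerSemicontinuous (g n)) {x : E} (hx : x ∈ interior {x | G x < ∞}) :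
    ∃ K : ℝ≥0∞, K < ∞ ∧ ∃ r > 0, ∀ᶠ n in atTop, ∀ y ∈ Metric.closedBall x r, g n y ≤ K := by
  obtain ⟨ρ, hρ, hball⟩ := Metric.nhds_basis_closedBall.mem_iff.1 (mem_interior_iff_mem_nhds.1 hx)
  obtain ⟨t, ht, hcov⟩ := (isCompact_closedBall x ρ).elim_nhds_subcover
    (fun y => Metric.ball y (ρ / 4)) fun y _ => Metric.ball_mem_nhds y (by positivity)
  have hK : ∑ y ∈ t, G y < ∞ := ENNReal.sum_lt_top.2 fun y hy => hball (ht y hy)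
  refine ⟨∑ y ∈ t, G y + 1, ENNReal.add_lt_top.2 ⟨hK, ENNReal.one_lt_top⟩, ρ / 2, by positivity, ?_⟩
  have h1 : ∀ᶠ n in atTop, ∀ y ∈ t, ∃ p ∈ Metric.ball y (ρ / 4), g n p < ∑ y ∈ t, G y + 1 := by
    rw [eventually_all_finset]
    intro y hy
    refine (h y).2 _ ?_ _ (Metric.ball_mem_nhds y (by positivity))
    exact (Finset.single_le_sum (fun _ _ => zero_le) hy).trans_lt
      (ENNReal.lt_add_right hK.ne one_ne_zero)
  filter_upwards [h1] with n hn
  refine ((hg n).convex_le _).closedBall_subset_of_dense ((hgc n).isClosed_preimage _) hρ.le ?_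
  intro w hw
  obtain ⟨y, hy, hwy⟩ := Set.mem_iUnion₂.1 (hcov hw)
  obtain ⟨p, hp, hpn⟩ := hn y hy
  refine ⟨p, hpn.le, ?_⟩
  have h2 := dist_triangle_right p w y
  rw [Metric.mem_ball] at hp hwy
  linarith

/-- A recovery point `p` near `x` need not be `x`. Writing `x` as `(1 - t) • p + t • z`, with `z` in
a ball where `g n ≤ K`, costs only `t * K`. -/
theorem eventually_le_of_mem_interior (h : EpiTendsto g G) (hg : ∀ n, ENNRealConvex (g n))
    (hgc : ∀ n, LowerSemicontinuous (g n)) {x : E} (hx : x ∈ interior {x | G x < ∞}) {c : ℝ≥0∞}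
    (hc : G x < c) : ∀ᶠ n in atTop, g n x ≤ c := by
  obtain ⟨K, hK, r, hr, hrn⟩ := h.eventually_bounded_of_mem_interior hg hgc hx
  obtain ⟨q, hq1, hq2⟩ := exists_between hc
  have hlim : Tendsto (fun t : ℝ => q + ENNReal.ofReal t * K) (𝓝[>] 0) (𝓝 q) := by
    have h1 : Tendsto (fun t : ℝ => q + ENNReal.ofReal t * K) (𝓝[>] 0)
        (𝓝 (q + ENNReal.ofReal 0 * K)) := by
      refine tendsto_const_nhds.add (ENNReal.Tendsto.mul_const ?_ (Or.inr hK.ne))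
      exact (ENNReal.continuous_ofReal.tendsto 0).mono_left nhdsWithin_le_nhds
    simpa using h1
  obtain ⟨t, ht, ht0, ht1⟩ := ((hlim.eventually (gt_mem_nhds hq2)).and
    (Ioo_mem_nhdsGT (zero_lt_one (α := ℝ)))).exists
  filter_upwards [hrn, (h x).2 q hq1 _ (Metric.closedBall_mem_nhds x (mul_pos ht0 hr))]
    with n hn hn2
  obtain ⟨p, hp, hpq⟩ := hn2
  have hz : p + t⁻¹ • (x - p) ∈ Metric.closedBall x r := by
    rw [mem_closedBall_iff_norm]
    have h1 : p + t⁻¹ • (x - p) - x = (t⁻¹ * (1 - t)) • (x - p) := by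
      rw [mul_sub, inv_mul_cancel₀ ht0.ne', mul_one]
      module
    rw [mem_closedBall_iff_norm'] at hp
    rw [h1, norm_smul, Real.norm_of_nonneg (mul_nonneg (inv_nonneg.2 ht0.le) (by linarith)),
      mul_assoc, inv_mul_le_iff₀ ht0]
    refine le_trans ?_ hp
    exact mul_le_of_le_one_left (norm_nonneg _) (by linarith)
  have h2 := (hg n).homothety_le p (p + t⁻¹ • (x - p)) ht0.le ht1.le
  have h3 : AffineMap.homothety p t (p + t⁻¹ • (x - p)) = x := by
    rw [AffineMap.homothety_apply, vsub_eq_sub, vadd_eq_add, add_sub_cancel_left, smul_smul,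
      mul_inv_cancel₀ ht0.ne', one_smul, sub_add_cancel]
  rw [h3] at h2
  refine h2.trans (le_trans ?_ ht.le)
  gcongr
  exact hn _ hz

/-- A negative power reverses order, so upper bounds on `g n` are needed: they hold on the interior
of the domain, the integrand `G ^ β` is zero off the domain, and the frontier is null. -/
theorem lintegral_rpow_le_liminf [MeasurableSpace E] [BorelSpace E] (h : EpiTendsto g G)
    (hg : ∀ n, ENNRealConvex (g n)) (hgc : ∀ n, LowerSemicontinuous (g n)) (μ : Measure E) [μ.IsAddHaarMeasure] {β : ℝ}
    (hβ : β < 0) :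
    ∫⁻ x, G x ^ β ∂μ ≤ liminf (fun n => ∫⁻ x, g n x ^ β ∂μ) atTop := by
  refine le_trans (lintegral_mono_ae ?_)
    (lintegral_liminf_le fun n => (hgc n).measurable.pow_const β)
  have hfr : ∀ᵐ x ∂μ, x ∉ frontier {x | G x < ∞} :=
    measure_eq_zero_iff_ae_notMem.1 ((h.ennrealConvex hg).convex_lt_top.addHaar_frontier μ)
  filter_upwards [hfr] with x hx
  by_cases hxG : G x < ∞
  · have hxi : x ∈ interior {x | G x < ∞} := by
      by_contra hxi
      exact hx ⟨subset_closure hxG, hxi⟩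
    refine le_of_forall_lt fun a ha => ?_
    have h1 : ∀ᶠ c in 𝓝[>] (G x), a < c ^ β :=
      ((ENNReal.continuous_rpow_const.tendsto (G x)).mono_left nhdsWithin_le_nhds).eventually
        (lt_mem_nhds ha)
    have : (𝓝[>] (G x)).NeBot := nhdsGT_neBot_of_exists_gt ⟨_, hxG⟩
    obtain ⟨c, hac, hc⟩ := (h1.and self_mem_nhdsWithin).exists
    refine hac.trans_le (le_liminf_of_le (by isBoundedDefault) ?_)
    filter_upwards [h.eventually_le_of_mem_interior hg hgc hxi hc] with n hn
    exact ENNReal.rpow_le_rpow_of_nonpos hn hβ.le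
  · rw [not_lt_top_iff.1 hxG, ENNReal.top_rpow_of_neg hβ]
    exact zero_le

end EpiTendsto

end InnerProduct

/-! ### Convexity inequalities for negative powers -/

section Powers

variable {p : ℝ}

theorem Real.one_add_mul_sub_lt_rpow_of_neg {u : ℝ} (hp : p < 0) (hu : 0 < u) (hu1 : u ≠ 1) :
    1 + p * (u - 1) < u ^ p := by
  have h1 := Real.log_lt_sub_one_of_pos hu hu1
  have h2 := Real.add_one_le_exp (Real.log u * p)
  rw [Real.rpow_def_of_pos hu]
  nlinarith

theorem Real.rpow_add_mul_sub_lt_rpow_of_neg {a b : ℝ} (hp : p < 0) (ha : 0 < a) (hb : 0 < b)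
    (hab : a ≠ b) : a ^ p + p * a ^ (p - 1) * (b - a) < b ^ p := by
  have h1 := Real.one_add_mul_sub_lt_rpow_of_neg hp (div_pos hb ha) (fun h => hab
    ((div_eq_one_iff_eq ha.ne').1 h).symm)
  rw [Real.div_rpow hb.le ha.le, lt_div_iff₀ (Real.rpow_pos_of_pos ha p)] at h1
  refine lt_of_eq_of_lt ?_ h1
  rw [Real.rpow_sub_one ha.ne']
  field_simp

namespace ENNReal

theorem rpow_midpoint_lt_of_neg {u v : ℝ≥0∞} (hp : p < 0) (hu : u ≠ 0) (hv : v ≠ 0)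
    (huv : u ≠ v) : (2⁻¹ * u + 2⁻¹ * v) ^ p < 2⁻¹ * u ^ p + 2⁻¹ * v ^ p := by
  rcases eq_or_ne u ∞ with rfl | hu'
  · rw [ENNReal.mul_top (by simp), top_add, ENNReal.top_rpow_of_neg hp, mul_zero, zero_add]
    exact ENNReal.mul_pos (by simp) (ENNReal.rpow_pos (pos_iff_ne_zero.2 hv) huv.symm).ne'
  rcases eq_or_ne v ∞ with rfl | hv'
  · rw [ENNReal.mul_top (by simp), add_top, ENNReal.top_rpow_of_neg hp, mul_zero, add_zero]
    exact ENNReal.mul_pos (by simp) (ENNReal.rpow_pos (pos_iff_ne_zero.2 hu) huv).ne'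
  have hur := ENNReal.toReal_pos hu hu'
  have hvr := ENNReal.toReal_pos hv hv'
  rw [← ENNReal.ofReal_toReal hu', ← ENNReal.ofReal_toReal hv'] at huv ⊢
  generalize u.toReal = a at *
  generalize v.toReal = b at *
  have hab : a ≠ b := fun h => huv (by rw [h])
  have h2 : (2⁻¹ : ℝ≥0∞) = ENNReal.ofReal 2⁻¹ := by
    rw [ENNReal.ofReal_inv_of_pos two_pos, ENNReal.ofReal_ofNat]
  rw [h2, ← ENNReal.ofReal_mul (by norm_num), ← ENNReal.ofReal_mul (by norm_num),
    ← ENNReal.ofReal_add (by positivity) (by positivity),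
    ENNReal.ofReal_rpow_of_pos (by positivity), ENNReal.ofReal_rpow_of_pos hur,
    ENNReal.ofReal_rpow_of_pos hvr, ← ENNReal.ofReal_mul (by norm_num),
    ← ENNReal.ofReal_mul (by norm_num), ← ENNReal.ofReal_add (by positivity) (by positivity),
    ENNReal.ofReal_lt_ofReal_iff (by positivity)]
  have h3 := Real.rpow_add_mul_sub_lt_rpow_of_neg (a := 2⁻¹ * a + 2⁻¹ * b) (b := a) hp
    (by positivity) hur (fun h => hab (by linarith))
  have h4 := Real.rpow_add_mul_sub_lt_rpow_of_neg (a := 2⁻¹ * a + 2⁻¹ * b) (b := b) hp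
    (by positivity) hvr (fun h => hab (by linarith))
  linarith

theorem rpow_midpoint_le_of_neg {u v : ℝ≥0∞} (hp : p < 0) (hu : u ≠ 0) (hv : v ≠ 0) :
    (2⁻¹ * u + 2⁻¹ * v) ^ p ≤ 2⁻¹ * u ^ p + 2⁻¹ * v ^ p := by
  rcases eq_or_ne u v with rfl | huv
  · rw [← add_mul, ← add_mul, ENNReal.inv_two_add_inv_two, one_mul, one_mul]
  · exact (rpow_midpoint_lt_of_neg hp hu hv huv).le

/-- The tangent line at `u + ε`, evaluated at `u`; the companion bound below uses the tangent at
`u`. -/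
theorem add_rpow_add_mul_le_of_neg {u : ℝ≥0∞} {ε : ℝ≥0} (hp : p < 0) (hu : u ≠ 0) (hε : 0 < ε) :
    (u + ε) ^ p + ENNReal.ofReal |p| * ε * (u + ε) ^ (p - 1) ≤ u ^ p := by
  rcases eq_or_ne u ∞ with rfl | hu'
  · rw [top_add, ENNReal.top_rpow_of_neg hp, ENNReal.top_rpow_of_neg (by linarith), mul_zero,
      add_zero]
  have hur := ENNReal.toReal_pos hu hu'
  have hε' : (0 : ℝ) < ε := hε
  rw [← ENNReal.ofReal_toReal hu', ← ENNReal.ofReal_coe_nnreal]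
  generalize u.toReal = a at *
  rw [← ENNReal.ofReal_add hur.le hε'.le, ENNReal.ofReal_rpow_of_pos (by positivity),
    ENNReal.ofReal_rpow_of_pos (by positivity), ENNReal.ofReal_rpow_of_pos hur,
    ← ENNReal.ofReal_mul (by positivity), ← ENNReal.ofReal_mul (by positivity),
    ← ENNReal.ofReal_add (by positivity) (by positivity), abs_of_neg hp]
  apply ENNReal.ofReal_le_ofReal
  have h3 := Real.rpow_add_mul_sub_lt_rpow_of_neg (a := a + ε) (b := a) hp
    (by positivity) hur (fun h => by linarith)
  refine le_trans (le_of_eq ?_) h3.le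
  ring

theorem rpow_le_add_rpow_add_mul_of_neg {u : ℝ≥0∞} {ε : ℝ≥0} (hp : p < 0) (hu : u ≠ 0)
    (hε : 0 < ε) : u ^ p ≤ (u + ε) ^ p + ENNReal.ofReal |p| * ε * u ^ (p - 1) := by
  rcases eq_or_ne u ∞ with rfl | hu'
  · rw [ENNReal.top_rpow_of_neg hp]
    exact zero_le
  have hur := ENNReal.toReal_pos hu hu'
  have hε' : (0 : ℝ) < ε := hε
  rw [← ENNReal.ofReal_toReal hu', ← ENNReal.ofReal_coe_nnreal]
  generalize u.toReal = a at *
  rw [← ENNReal.ofReal_add hur.le hε'.le, ENNReal.ofReal_rpow_of_pos (by positivity),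
    ENNReal.ofReal_rpow_of_pos (by positivity), ENNReal.ofReal_rpow_of_pos hur,
    ← ENNReal.ofReal_mul (by positivity), ← ENNReal.ofReal_mul (by positivity),
    ← ENNReal.ofReal_add (by positivity) (by positivity), abs_of_neg hp]
  apply ENNReal.ofReal_le_ofReal
  have h3 := Real.rpow_add_mul_sub_lt_rpow_of_neg (a := a) (b := a + ε) hp
    hur (by positivity) (fun h => by linarith)
  rw [add_sub_cancel_left] at h3
  linarith

end ENNReal

end Powers

theorem LowerSemicontinuous.exists_pos_le_of_coercive {E : Type*} [NormedAddCommGroup E]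
    [ProperSpace E] {g : E → ℝ≥0∞} (hg : LowerSemicontinuous g)
    (hco : Tendsto g (Bornology.cobounded E) (𝓝 ∞)) (hpos : ∀ x, 0 < g x) :
    ∃ c : ℝ≥0, 0 < c ∧ ∀ x, (c : ℝ≥0∞) ≤ g x := by
  obtain ⟨R, -, hR⟩ := (Filter.hasBasis_cobounded_norm (E := E)).eventually_iff.1
    (hco.eventually (lt_mem_nhds ENNReal.one_lt_top))
  have hne : (Metric.closedBall (0 : E) |R|).Nonempty := ⟨0, by simp⟩
  obtain ⟨y, -, hy⟩ := (hg.lowerSemicontinuousOn _).exists_isMinOn hne (isCompact_closedBall 0 |R|)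
  -- The cap at `1` covers the points outside the ball and keeps the bound finite even if `g y = ∞`.
  have hm : min 1 (g y) ≠ ∞ := ((min_le_left _ _).trans_lt ENNReal.one_lt_top).ne
  refine ⟨(min 1 (g y)).toNNReal, ENNReal.toNNReal_pos (lt_min one_pos (hpos y)).ne' hm, fun x => ?_⟩
  rw [ENNReal.coe_toNNReal hm]
  by_cases hx : x ∈ Metric.closedBall (0 : E) |R|
  · exact (min_le_right _ _).trans (hy hx)
  · rw [mem_closedBall_zero_iff, not_le] at hx
    exact (min_le_left _ _).trans (hR ((le_abs_self R).trans hx.le)).le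

theorem ENNReal.liminf_add_liminf_le (u v : ℕ → ℝ≥0∞) :
    liminf u atTop + liminf v atTop ≤ liminf (fun n => u n + v n) atTop := by
  have hmono : ∀ w : ℕ → ℝ≥0∞, Monotone fun n => ⨅ i ≥ n, w i := fun w m n hmn =>
    le_iInf₂ fun i hi => iInf₂_le i (hmn.trans hi)
  simp only [liminf_eq_iSup_iInf_of_nat]
  rw [ENNReal.iSup_add_iSup_of_monotone (hmono u) (hmono v)]
  exact iSup_mono fun n => le_iInf₂ fun i hi => add_le_add (iInf₂_le i hi) (iInf₂_le i hi)

/-! ### Stability of the class and the first moment -/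

namespace IsCoerciveClosedConvex

variable {d : ℕ} {g : EuclideanSpace ℝ (Fin d) → ℝ≥0∞}

theorem measurable (hg : IsCoerciveClosedConvex g) : Measurable g := hg.closed.measurable

theorem ennrealConvex (hg : IsCoerciveClosedConvex g) : ENNRealConvex g := hg.convex

theorem add_const (hg : IsCoerciveClosedConvex g) (ε : ℝ≥0) :
    IsCoerciveClosedConvex fun x => g x + ε where
  convex := hg.ennrealConvex.add (ENNRealConvex.const ε)
  closed := hg.closed.add lowerSemicontinuous_const
  interior_dom := by simpa [ENNReal.add_lt_top] using hg.interior_dom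
  coercive := by simpa using hg.coercive.add (tendsto_const_nhds (x := (ε : ℝ≥0∞)))

theorem sub_const (hg : IsCoerciveClosedConvex g) {ε : ℝ≥0} (hε : ∀ x, (ε : ℝ≥0∞) ≤ g x) :
    IsCoerciveClosedConvex fun x => g x - ε where
  convex := hg.ennrealConvex.sub_const hε
  closed := (ENNReal.continuous_sub_right ε).comp_lowerSemicontinuous hg.closed
    fun _ _ h => tsub_le_tsub_right h _
  interior_dom := by
    refine hg.interior_dom.mono (interior_mono fun x hx => ?_)
    exact tsub_le_self.trans_lt (show g x < ∞ from hx)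
  coercive := by
    have h := ((ENNReal.continuous_sub_right (ε : ℝ≥0∞)).tendsto ∞).comp hg.coercive
    rwa [ENNReal.top_sub_coe] at h

theorem one_add_norm : IsCoerciveClosedConvex
    fun x : EuclideanSpace ℝ (Fin d) => 1 + ENNReal.ofReal ‖x‖ where
  convex := (ENNRealConvex.const 1).add ENNRealConvex.norm
  closed := (continuous_const.add
    (ENNReal.continuous_ofReal.comp continuous_norm)).lowerSemicontinuous
  interior_dom := by simp [ENNReal.add_lt_top]
  coercive := by
    simpa using (tendsto_const_nhds (x := (1 : ℝ≥0∞))).add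
      (ENNReal.tendsto_ofReal_atTop.comp (tendsto_norm_cobounded_atTop
        (E := EuclideanSpace ℝ (Fin d))))

theorem hasFiniteFirstMoment (hg : IsCoerciveClosedConvex g)
    {Q : Measure (EuclideanSpace ℝ (Fin d))} [IsFiniteMeasure Q] (hfin : ∫⁻ x, g x ∂Q < ∞) :
    HasFiniteFirstMoment Q := by
  obtain ⟨x₀, hx₀⟩ := hg.interior_dom
  obtain ⟨R, hR⟩ := hg.ennrealConvex.exists_norm_le_of_coercive
    (interior_subset (s := {x | g x < ∞}) hx₀) hg.coercive
  refine (lintegral_mono hR).trans_lt ?_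
  rw [lintegral_add_right _ measurable_const, lintegral_const_mul _ hg.measurable,
    lintegral_const]
  exact ENNReal.add_lt_top.2 ⟨ENNReal.mul_lt_top ENNReal.coe_lt_top hfin,
    ENNReal.mul_lt_top ENNReal.coe_lt_top (measure_lt_top _ _)⟩

end IsCoerciveClosedConvex

/-- The exponent `β = 1 + 1 / s` lies below `-d` if `-1 / (d + 1) < s < 0`. -/
theorem one_add_one_div_lt_neg {a s : ℝ} (ha : 0 ≤ a) (hs : -1 / (a + 1) < s) (hs0 : s < 0) :
    1 + 1 / s < -a := by
  rw [div_lt_iff₀ (by positivity)] at hs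
  have h1 : 1 / s < -(a + 1) := by
    rw [div_lt_iff_of_neg hs0]
    linarith
  linarith

/-! ### The functional: existence, uniqueness and normalization -/

section Functional

variable {d : ℕ} {s : ℝ} {Q : Measure (EuclideanSpace ℝ (Fin d))}
  {g h : EuclideanSpace ℝ (Fin d) → ℝ≥0∞}

theorem ofReal_abs_inv_pos {β : ℝ} (hβ : β < 0) : 0 < ENNReal.ofReal |β|⁻¹ :=
  ENNReal.ofReal_pos.2 (inv_pos.2 (abs_pos.2 hβ.ne))

theorem lintegral_lt_top_of_renyiFunctional_lt_top (hfin : renyiFunctional s Q g < ∞) :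
    ∫⁻ x, g x ∂Q < ∞ := (ENNReal.add_lt_top.1 hfin).1

theorem lintegral_rpow_lt_top_of_renyiFunctional_lt_top (hβ : 1 + 1 / s < 0)
    (hfin : renyiFunctional s Q g < ∞) : ∫⁻ x, g x ^ (1 + 1 / s) < ∞ :=
  ENNReal.lt_top_of_mul_ne_top_right (ENNReal.add_lt_top.1 hfin).2.ne (ofReal_abs_inv_pos hβ).ne'

theorem ofReal_abs_inv_mul {β : ℝ} (hβ : β < 0) (a : ℝ≥0∞) :
    ENNReal.ofReal |β|⁻¹ * (ENNReal.ofReal |β| * a) = a := by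
  rw [← mul_assoc, ← ENNReal.ofReal_mul (by positivity),
    inv_mul_cancel₀ (abs_pos.2 hβ.ne).ne', ENNReal.ofReal_one, one_mul]

theorem IsCoerciveClosedConvex.pos_of_renyiFunctional_lt_top (hg : IsCoerciveClosedConvex g)
    (hβ : 1 + 1 / s < -(d : ℝ)) (hfin : renyiFunctional s Q g < ∞) (x) : 0 < g x := by
  have hβ0 : 1 + 1 / s < 0 := hβ.trans_le (by simp)
  exact hg.ennrealConvex.pos_of_lintegral_rpow_lt_top volume hg.measurable hg.interior_dom
    (by rwa [finrank_euclideanSpace_fin])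
    (lintegral_rpow_lt_top_of_renyiFunctional_lt_top hβ0 hfin) x

theorem renyiInf_le (hg : g ∈ coerciveClosedConvex d) : renyiInf s Q ≤ renyiFunctional s Q g :=
  iInf₂_le g hg

theorem EpiTendsto.renyiFunctional_le {g : ℕ → EuclideanSpace ℝ (Fin d) → ℝ≥0∞}
    {G : EuclideanSpace ℝ (Fin d) → ℝ≥0∞} (h : EpiTendsto g G) (hβ : 1 + 1 / s < 0)
    (hg : ∀ n, ENNRealConvex (g n)) (hgc : ∀ n, LowerSemicontinuous (g n)) :
    renyiFunctional s Q G ≤ liminf (fun n => renyiFunctional s Q (g n)) atTop := by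
  set C : ℝ≥0∞ := ENNReal.ofReal (|1 + 1 / s|⁻¹) with hC
  have h1 : C * ∫⁻ x, G x ^ (1 + 1 / s)
      ≤ liminf (fun n => C * ∫⁻ x, g n x ^ (1 + 1 / s)) atTop := by
    refine (mul_le_mul_right (h.lintegral_rpow_le_liminf hg hgc volume hβ) C).trans ?_
    have h2 := ENNReal.le_liminf_mul (f := atTop) (u := fun _ : ℕ => C)
      (v := fun n => ∫⁻ x, g n x ^ (1 + 1 / s))
    rwa [liminf_const] at h2
  refine (add_le_add (h.lintegral_le_liminf hgc Q) h1).trans ?_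
  exact ENNReal.liminf_add_liminf_le (u := fun n => ∫⁻ x, g n x ∂Q)
    (v := fun n => C * ∫⁻ x, g n x ^ (1 + 1 / s))

variable [IsProbabilityMeasure Q]

theorem renyiFunctional_one_add_norm_lt_top (hβ : 1 + 1 / s < -(d : ℝ))
    (hQ : HasFiniteFirstMoment Q) :
    renyiFunctional s Q (fun x => 1 + ENNReal.ofReal ‖x‖) < ∞ := by
  rw [renyiFunctional]
  refine ENNReal.add_lt_top.2 ⟨?_, ENNReal.mul_lt_top ENNReal.ofReal_lt_top ?_⟩
  · rw [lintegral_add_left measurable_const, lintegral_const]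
    refine ENNReal.add_lt_top.2 ⟨by simp, ?_⟩
    simp only [ofReal_norm]
    exact hQ
  · have h1 := finite_integral_one_add_norm (E := EuclideanSpace ℝ (Fin d)) (μ := volume)
      (r := -(1 + 1 / s)) (by rw [finrank_euclideanSpace_fin]; linarith)
    rw [neg_neg] at h1
    refine lt_of_eq_of_lt (lintegral_congr fun x => ?_) h1
    rw [← ENNReal.ofReal_rpow_of_pos (by positivity), ENNReal.ofReal_add zero_le_one
      (norm_nonneg _), ENNReal.ofReal_one]

theorem interior_dom_nonempty (hQ : (interior (convexSupport Q)).Nonempty)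
    (hg : ENNRealConvex g) (hgc : LowerSemicontinuous g) (hfin : ∫⁻ x, g x ∂Q < ∞) :
    (interior {x | g x < ∞}).Nonempty := by
  refine interior_nonempty_of_convexSupport hQ hg.convex_lt_top ?_
  exact (prob_compl_eq_zero_iff (measurableSet_lt hgc.measurable measurable_const)).1
    (ae_lt_top hgc.measurable hfin.ne)

/-- A closed convex function at which the functional is finite is automatically coercive. -/
theorem isCoerciveClosedConvex_of_renyiFunctional_lt_top (hβ : 1 + 1 / s < 0)
    (hQ : (interior (convexSupport Q)).Nonempty) (hg : ENNRealConvex g)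
    (hgc : LowerSemicontinuous g) (hfin : renyiFunctional s Q g < ∞) :
    IsCoerciveClosedConvex g :=
  have hdom := interior_dom_nonempty hQ hg hgc (lintegral_lt_top_of_renyiFunctional_lt_top hfin)
  ⟨hg, hgc, hdom, hg.coercive_of_lintegral_rpow_lt_top volume hgc.measurable hdom hβ
    (lintegral_rpow_lt_top_of_renyiFunctional_lt_top hβ hfin)⟩

theorem renyiInf_lt_top_iff (hβ : 1 + 1 / s < -(d : ℝ)) :
    renyiInf s Q < ∞ ↔ HasFiniteFirstMoment Q := by
  constructor
  · intro h
    simp only [renyiInf, iInf_lt_iff] at h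
    obtain ⟨g, hg, hfin⟩ := h
    exact IsCoerciveClosedConvex.hasFiniteFirstMoment hg
      (lintegral_lt_top_of_renyiFunctional_lt_top hfin)
  · intro h
    exact (renyiInf_le (IsCoerciveClosedConvex.one_add_norm (d := d))).trans_lt
      (renyiFunctional_one_add_norm_lt_top hβ h)

/-- Existence of a minimizer. -/
theorem exists_renyiFunctional_eq_renyiInf (hβ : 1 + 1 / s < 0)
    (hQ : (interior (convexSupport Q)).Nonempty) (hfin : renyiInf s Q < ∞) :
    ∃ g ∈ coerciveClosedConvex d, renyiFunctional s Q g = renyiInf s Q := by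
  obtain ⟨u, -, hu, hulim⟩ := exists_seq_strictAnti_tendsto' hfin
  have h1 : ∀ n, ∃ g ∈ coerciveClosedConvex d, renyiFunctional s Q g < u n := by
    intro n
    have h2 : renyiInf s Q < u n := (hu n).1
    simpa only [renyiInf, iInf_lt_iff, exists_prop] using h2
  choose g hg hgu using h1
  obtain ⟨φ, hφ, G, hG⟩ := exists_epiTendsto_subseq g
  have hle : renyiFunctional s Q G ≤ renyiInf s Q := by
    refine (hG.renyiFunctional_le hβ (fun n => (hg _).convex) fun n => (hg _).closed).trans ?_
    rw [← (hulim.comp hφ.tendsto_atTop).liminf_eq]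
    exact liminf_le_liminf (Eventually.of_forall fun n => (hgu _).le)
  have hmem : G ∈ coerciveClosedConvex d :=
    isCoerciveClosedConvex_of_renyiFunctional_lt_top hβ hQ
      (hG.ennrealConvex fun n => (hg _).convex) hG.lowerSemicontinuous (hle.trans_lt hfin)
  exact ⟨G, hmem, le_antisymm hle (renyiInf_le hmem)⟩

/-- Uniqueness of the minimizer. -/
theorem eq_of_renyiFunctional_eq_renyiInf (hβ : 1 + 1 / s < -(d : ℝ))
    (hQ : (interior (convexSupport Q)).Nonempty) (hfin : renyiInf s Q < ∞)
    (hg : g ∈ coerciveClosedConvex d) (hh : h ∈ coerciveClosedConvex d)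
    (hgm : renyiFunctional s Q g = renyiInf s Q) (hhm : renyiFunctional s Q h = renyiInf s Q) :
    g = h := by
  have hβ0 : 1 + 1 / s < 0 := hβ.trans_le (by simp)
  have hgfin : renyiFunctional s Q g < ∞ := hgm ▸ hfin
  have hhfin : renyiFunctional s Q h < ∞ := hhm ▸ hfin
  have hg0 := hg.pos_of_renyiFunctional_lt_top hβ hgfin
  have hh0 := hh.pos_of_renyiFunctional_lt_top hβ hhfin
  set β := 1 + 1 / s with hβdef
  have hC := (ofReal_abs_inv_pos hβ0).ne'
  set C : ℝ≥0∞ := ENNReal.ofReal (|β|⁻¹) with hCdef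
  set k : EuclideanSpace ℝ (Fin d) → ℝ≥0∞ := fun x => 2⁻¹ * g x + 2⁻¹ * h x with hk
  have hpow_le : ∀ x, k x ^ β ≤ 2⁻¹ * g x ^ β + 2⁻¹ * h x ^ β := fun x =>
    ENNReal.rpow_midpoint_le_of_neg hβ0 (hg0 x).ne' (hh0 x).ne'
  set A := ∫⁻ x, k x ∂Q with hA
  set B := ∫⁻ x, 2⁻¹ * g x ^ β + 2⁻¹ * h x ^ β with hB
  have hsum : A + C * B = renyiInf s Q := by
    have hA' : A = 2⁻¹ * ∫⁻ x, g x ∂Q + 2⁻¹ * ∫⁻ x, h x ∂Q := by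
      rw [hA, lintegral_add_left (hg.measurable.const_mul _), lintegral_const_mul _ hg.measurable,
        lintegral_const_mul _ hh.measurable]
    have hB' : B = 2⁻¹ * (∫⁻ x, g x ^ β) + 2⁻¹ * ∫⁻ x, h x ^ β := by
      rw [hB, lintegral_add_left ((hg.measurable.pow_const _).const_mul _),
        lintegral_const_mul _ (hg.measurable.pow_const _),
        lintegral_const_mul _ (hh.measurable.pow_const _)]
    calc A + C * B = 2⁻¹ * renyiFunctional s Q g + 2⁻¹ * renyiFunctional s Q h := by
          rw [hA', hB', renyiFunctional, renyiFunctional]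
          ring
      _ = renyiInf s Q := by
          rw [hgm, hhm, ← add_mul, ENNReal.inv_two_add_inv_two, one_mul]
  have hkle : renyiFunctional s Q k ≤ A + C * B :=
    add_le_add le_rfl (mul_le_mul_right (lintegral_mono hpow_le) C)
  have hkfin : renyiFunctional s Q k < ∞ := hkle.trans_lt (hsum ▸ hfin)
  have hkc : LowerSemicontinuous k := by
    have hmul : ∀ {f : EuclideanSpace ℝ (Fin d) → ℝ≥0∞}, LowerSemicontinuous f →
        LowerSemicontinuous fun x => 2⁻¹ * f x := fun hf =>
      (ENNReal.continuous_const_mul (by simp)).comp_lowerSemicontinuous hf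
        fun _ _ h => mul_le_mul_right h _
    exact (hmul hg.closed).add (hmul hh.closed)
  have hkmem : k ∈ coerciveClosedConvex d :=
    isCoerciveClosedConvex_of_renyiFunctional_lt_top hβ0 hQ
      ((hg.ennrealConvex.const_mul _).add (hh.ennrealConvex.const_mul _)) hkc hkfin
  -- The midpoint `k` is a competitor, so minimality forces equality a.e. in the midpoint inequality
  -- for the power.
  have hBle : B ≤ ∫⁻ x, k x ^ β := by
    have h1 : A + C * B ≤ A + C * ∫⁻ x, k x ^ β := hsum ▸ renyiInf_le hkmem
    rwa [ENNReal.add_le_add_iff_left (lintegral_lt_top_of_renyiFunctional_lt_top hkfin).ne,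
      ENNReal.mul_le_mul_iff_right hC ENNReal.ofReal_ne_top] at h1
  have hae := ae_eq_of_ae_le_of_lintegral_le (Eventually.of_forall hpow_le)
    (lintegral_rpow_lt_top_of_renyiFunctional_lt_top hβ0 hkfin).ne
    (((hg.measurable.pow_const _).const_mul _).add
      ((hh.measurable.pow_const _).const_mul _)).aemeasurable hBle
  have hgh : g =ᵐ[volume] h := by
    filter_upwards [hae] with x hx
    by_contra hne
    exact (ENNReal.rpow_midpoint_lt_of_neg hβ0 (hg0 x).ne' (hh0 x).ne' hne).ne hx
  exact le_antisymm (hh.ennrealConvex.le_of_ae_eq volume hg.closed hh.interior_dom hgh)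
    (hg.ennrealConvex.le_of_ae_eq volume hh.closed hg.interior_dom hgh.symm)

theorem renyiFunctional_add_const (hg : Measurable g) (ε : ℝ≥0) :
    renyiFunctional s Q (fun x => g x + ε) = ∫⁻ x, g x ∂Q + ε +
      ENNReal.ofReal (|1 + 1 / s|⁻¹) * ∫⁻ x, (g x + ε) ^ (1 + 1 / s) := by
  rw [renyiFunctional, lintegral_add_left hg, lintegral_const, measure_univ, mul_one]

/-- Perturbing a minimizer upwards. -/
theorem lintegral_add_const_rpow_le_one (hβ : 1 + 1 / s < 0) (hg : g ∈ coerciveClosedConvex d)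
    (hgm : renyiFunctional s Q g = renyiInf s Q) (hfin : renyiInf s Q < ∞) (hg0 : ∀ x, 0 < g x)
    {ε : ℝ≥0} (hε : 0 < ε) : ∫⁻ x, (g x + ε) ^ (1 / s) ≤ 1 := by
  have h1 : renyiFunctional s Q g ≤ renyiFunctional s Q (fun x => g x + ε) :=
    hgm ▸ renyiInf_le (hg.add_const ε)
  have hgfin : renyiFunctional s Q g < ∞ := hgm ▸ hfin
  rw [renyiFunctional_add_const hg.measurable] at h1
  set β := 1 + 1 / s with hβdef
  have hs : 1 / s = β - 1 := by rw [hβdef]; ring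
  have hm := hg.measurable
  have h2 : (∫⁻ x, (g x + ε) ^ β) + ENNReal.ofReal |β| * (ε * ∫⁻ x, (g x + ε) ^ (1 / s))
      ≤ ∫⁻ x, g x ^ β := by
    rw [← mul_assoc, ← lintegral_const_mul _ ((hm.add_const _).pow_const _),
      ← lintegral_add_left ((hm.add_const _).pow_const _), hs]
    exact lintegral_mono fun x => ENNReal.add_rpow_add_mul_le_of_neg hβ (hg0 x).ne' hε
  have h3 := add_le_add (le_refl (∫⁻ x, g x ∂Q))
    (mul_le_mul_right h2 (ENNReal.ofReal |β|⁻¹))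
  have h4 := h3.trans h1
  rw [mul_add, ofReal_abs_inv_mul hβ, add_assoc, ENNReal.add_le_add_iff_left
    (lintegral_lt_top_of_renyiFunctional_lt_top hgfin).ne, add_comm (ε : ℝ≥0∞),
    ENNReal.add_le_add_iff_left] at h4
  · rwa [← ENNReal.mul_le_mul_iff_right (a := (ε : ℝ≥0∞)) (by exact_mod_cast hε.ne')
      ENNReal.coe_ne_top, mul_one]
  · refine ENNReal.mul_ne_top ENNReal.ofReal_ne_top (ne_top_of_le_ne_top
      (lintegral_rpow_lt_top_of_renyiFunctional_lt_top hβ hgfin).ne (lintegral_mono fun x => ?_))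
    exact ENNReal.rpow_le_rpow_of_nonpos le_self_add hβ.le

/-- Perturbing a minimizer downwards. -/
theorem one_le_lintegral_rpow_of_add_const (hβ : 1 + 1 / s < 0) (hh : h ∈ coerciveClosedConvex d)
    {ε : ℝ≥0} (hε : 0 < ε) (hm : renyiFunctional s Q (fun x => h x + ε) = renyiInf s Q)
    (hfin : renyiInf s Q < ∞) (hh0 : ∀ x, 0 < h x) : 1 ≤ ∫⁻ x, h x ^ (1 / s) := by
  have h1 : renyiFunctional s Q (fun x => h x + ε) ≤ renyiFunctional s Q h := hm ▸ renyiInf_le hh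
  have hmeas := hh.measurable
  rw [renyiFunctional_add_const hmeas] at h1 hm
  rw [← hm] at hfin
  rw [renyiFunctional] at h1
  set β := 1 + 1 / s with hβdef
  have hs : 1 / s = β - 1 := by rw [hβdef]; ring
  have h2 : ∫⁻ x, h x ^ β
      ≤ (∫⁻ x, (h x + ε) ^ β) + ENNReal.ofReal |β| * (ε * ∫⁻ x, h x ^ (1 / s)) := by
    rw [← mul_assoc, ← lintegral_const_mul _ (hmeas.pow_const _),
      ← lintegral_add_left ((hmeas.add_const _).pow_const _), hs]
    exact lintegral_mono fun x => ENNReal.rpow_le_add_rpow_add_mul_of_neg hβ (hh0 x).ne' hε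
  have h3 := h1.trans (add_le_add (le_refl (∫⁻ x, h x ∂Q))
    (mul_le_mul_right h2 (ENNReal.ofReal |β|⁻¹)))
  rw [mul_add, ofReal_abs_inv_mul hβ, ← add_assoc, add_right_comm,
    ENNReal.add_le_add_iff_left] at h3
  · rwa [← ENNReal.mul_le_mul_iff_right (a := (ε : ℝ≥0∞)) (by exact_mod_cast hε.ne')
      ENNReal.coe_ne_top, mul_one]
  · rw [add_right_comm] at hfin
    exact (ENNReal.add_lt_top.1 hfin).1.ne

/-- Since `c * δ ≤ δ * g`, shifts by `c * δ` compare with scalings: `g + c * δ ≤ (1 + δ) * g` and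
`(1 - δ) * g ≤ g - c * δ`. A scaling leaves the integral as a factor, so `δ → 0` needs no
convergence theorem. -/
theorem lintegral_rpow_eq_one (hβ : 1 + 1 / s < 0) (hs : 1 / s < 0)
    (hg : g ∈ coerciveClosedConvex d) (hgm : renyiFunctional s Q g = renyiInf s Q)
    (hfin : renyiInf s Q < ∞) {c : ℝ≥0} (hc : 0 < c) (hcg : ∀ x, (c : ℝ≥0∞) ≤ g x) :
    ∫⁻ x, g x ^ (1 / s) = 1 := by
  have hc' : (0 : ℝ≥0∞) < c := by exact_mod_cast hc
  have hg0 : ∀ x, 0 < g x := fun x => hc'.trans_le (hcg x)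
  have hmul : ∀ a : ℝ≥0∞, a ≠ 0 →
      a ^ (1 / s) * ∫⁻ x, g x ^ (1 / s) = ∫⁻ x, (a * g x) ^ (1 / s) := by
    intro a ha
    rw [← lintegral_const_mul _ (hg.measurable.pow_const _)]
    exact lintegral_congr fun x => (ENNReal.mul_rpow_of_ne_zero ha (hg0 x).ne' _).symm
  have hlim : ∀ f : ℝ≥0 → ℝ≥0, Continuous f → f 0 = 1 →
      Tendsto (fun δ => (f δ : ℝ≥0∞) ^ (1 / s) * ∫⁻ x, g x ^ (1 / s)) (𝓝[>] 0)
        (𝓝 (∫⁻ x, g x ^ (1 / s))) := by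
    intro f hf hf0
    have h1 : Tendsto (fun δ => (f δ : ℝ≥0∞) ^ (1 / s)) (𝓝[>] 0) (𝓝 1) := by
      have h2 := ((ENNReal.continuous_rpow_const (y := 1 / s)).comp
        (ENNReal.continuous_coe.comp hf)).tendsto 0
      simp only [Function.comp_apply, hf0, ENNReal.coe_one, ENNReal.one_rpow] at h2
      exact h2.mono_left nhdsWithin_le_nhds
    -- The limit `1` of the first factor is nonzero, so the integral need not be known finite.
    simpa using ENNReal.Tendsto.mul_const h1 (Or.inl one_ne_zero)
  apply le_antisymm
  · refine le_of_tendsto (hlim (fun δ => 1 + δ) (by fun_prop) (by simp)) ?_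
    filter_upwards [self_mem_nhdsWithin] with δ hδ
    rw [hmul _ (by simp)]
    refine le_trans (lintegral_mono fun x => ENNReal.rpow_le_rpow_of_nonpos ?_ hs.le)
      (lintegral_add_const_rpow_le_one hβ hg hgm hfin hg0 (mul_pos hc hδ))
    rw [ENNReal.coe_add, ENNReal.coe_one, add_mul, one_mul, ENNReal.coe_mul,
      mul_comm (c : ℝ≥0∞)]
    gcongr
    exact hcg x
  · refine ge_of_tendsto (hlim (fun δ => 1 - δ) (by fun_prop) (by simp)) ?_
    filter_upwards [Ioo_mem_nhdsGT (zero_lt_one (α := ℝ≥0))] with δ hδ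
    have hlt : ∀ x, ((c * δ : ℝ≥0) : ℝ≥0∞) < g x := fun x =>
      lt_of_lt_of_le (ENNReal.coe_lt_coe.2 (mul_lt_of_lt_one_right hc hδ.2)) (hcg x)
    rw [hmul _ (by exact_mod_cast (tsub_pos_of_lt hδ.2).ne')]
    -- Here `h` is the minimizer lowered by `c * δ`; the bound `c * δ < g` ensures that adding the
    -- constant back recovers `g`.
    refine le_trans (one_le_lintegral_rpow_of_add_const (Q := Q)
      (h := fun x => g x - ((c * δ : ℝ≥0) : ℝ≥0∞)) hβ (hg.sub_const fun x => (hlt x).le)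
      (mul_pos hc hδ.1) ?_ hfin fun x => tsub_pos_of_lt (hlt x))
      (lintegral_mono fun x => ENNReal.rpow_le_rpow_of_nonpos ?_ hs.le)
    · simp only [tsub_add_cancel_of_le (hlt _).le]
      exact hgm
    · refine ENNReal.le_sub_of_add_le_right ENNReal.coe_ne_top ?_
      calc ((1 - δ : ℝ≥0) : ℝ≥0∞) * g x + ((c * δ : ℝ≥0) : ℝ≥0∞)
          ≤ ((1 - δ : ℝ≥0) : ℝ≥0∞) * g x + δ * g x := by
            rw [ENNReal.coe_mul, mul_comm (c : ℝ≥0∞)]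
            gcongr
            exact hcg x
        _ = g x := by
            rw [← add_mul, ← ENNReal.coe_add, tsub_add_cancel_of_le hδ.2.le, ENNReal.coe_one,
              one_mul]

end Functional

theorem mainTheorem2 (d : ℕ) (s : ℝ) (hs : -1 / ((d : ℝ) + 1) < s) (hs0 : s < 0)
    (Q : Measure (EuclideanSpace ℝ (Fin d))) [IsProbabilityMeasure Q]
    (hQ : (interior (convexSupport Q)).Nonempty) :
    (renyiInf s Q < ∞ ↔ HasFiniteFirstMoment Q) ∧
    (HasFiniteFirstMoment Q →
      ∃ g ∈ coerciveClosedConvex d,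
        IsMinOn (renyiFunctional s Q) (coerciveClosedConvex d) g ∧
        (∀ h ∈ coerciveClosedConvex d,
          IsMinOn (renyiFunctional s Q) (coerciveClosedConvex d) h → h = g) ∧
        0 < renyiFunctional s Q g ∧ renyiFunctional s Q g < ∞ ∧
        (∃ c : ℝ≥0, 0 < c ∧ ∀ x, (c : ℝ≥0∞) ≤ g x) ∧
        IsBoundedDensity (fun x => (g x) ^ (1 / s))) := by
  have hβ : 1 + 1 / s < -(d : ℝ) := one_add_one_div_lt_neg (Nat.cast_nonneg d) hs hs0
  have hβ0 : 1 + 1 / s < 0 := hβ.trans_le (by simp)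
  have hs' : 1 / s < 0 := one_div_neg.2 hs0
  refine ⟨renyiInf_lt_top_iff hβ, fun hmom => ?_⟩
  have hfin : renyiInf s Q < ∞ := (renyiInf_lt_top_iff hβ).2 hmom
  obtain ⟨g, hg, hgm⟩ := exists_renyiFunctional_eq_renyiInf hβ0 hQ hfin
  have hgfin : renyiFunctional s Q g < ∞ := hgm ▸ hfin
  obtain ⟨c, hc, hcg⟩ := LowerSemicontinuous.exists_pos_le_of_coercive hg.closed hg.coercive
    (hg.pos_of_renyiFunctional_lt_top hβ hgfin)
  refine ⟨g, hg, fun h hh => hgm.trans_le (renyiInf_le hh), fun h hh hmin => ?_, ?_, hgfin,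
    ⟨c, hc, hcg⟩, ⟨hg.measurable.pow_const _, lintegral_rpow_eq_one hβ0 hs' hg hgm hfin hc hcg,
      c ^ (1 / s), fun x => ?_⟩⟩
  · have hhm : renyiFunctional s Q h = renyiInf s Q :=
      le_antisymm ((hmin hg).trans_eq hgm) (renyiInf_le hh)
    exact eq_of_renyiFunctional_eq_renyiInf hβ hQ hfin hh hg hhm hgm
  · have h1 : (c : ℝ≥0∞) ≤ ∫⁻ x, g x ∂Q := by
      simpa using lintegral_mono (μ := Q) hcg
    exact (ENNReal.coe_pos.2 hc).trans_le (h1.trans le_self_add)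
  · rw [ENNReal.coe_rpow_of_ne_zero hc.ne']
    exact ENNReal.rpow_le_rpow_of_nonpos (hcg x) hs'.le
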